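/- Let $n$ be a positive integer. A Stirling permutation of order $n$ is a word $\pi=\pi_1\pi_2\cdots\pi_{2n}$ that is a permutation of the multiset $\{1,1,2,2,\ldots,n,n\}$ such that, whenever $1\le i<k<j\le 2n$ and $\pi_i=\pi_j$, one has $\pi_k>\pi_i$. Let $\mathcal{Q}_n$ denote the set of Stirling permutations of order $n$, and put $\pi_0=0$. For $\pi\in\mathcal{Q}_n$, let $$P(\pi)=\{i:\ 1\le i<2n,\ \pi_i=\pi_{i+1}\}$$ be the set of plateaux of $\pi$, and let $$FA(\pi)=\{i:\ 0\le i<2n,\ \pi_i<\pi_{i+1}\text{ and }\pi_j\ne\pi_i\text{ for all }1\le j<i\}$$ be the set of first-appearance ascents of $\pi$. A polynomial $f\in\mathbb{R}[z_1,\ldots,z_m]$ is called real stable if either $f$ is identically zero or $f(z_1,\ldots,z_m)\neq 0$ for all $z_1,\ldots,z_m\in\mathbb{C}$ with $\operatorname{Im} z_1>0,\ldots,\operatorname{Im} z_m>0$. Theorem. For every positive integer $n$, the polynomial $$\sum_{\pi\in\mathcal{Q}_n}\ \prod_{i\in P(\pi)}x_{\pi_i}\prod_{j\in FA(\pi)}y_{\pi_{j+1}}$$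 in the variables $x_1,\ldots,x_n,y_1,\ldots,y_n$ is real stable. -/

import Mathlib

/-- A polynomial with real coefficients is (real) stable if it is identically zero or has no zero
all of whose coordinates lie in the open upper half-plane. -/
def IsRealStable {σ : Type*} (f : MvPolynomial σ ℝ) : Prop :=
  f = 0 ∨ ∀ z : σ → ℂ, (∀ i, 0 < (z i).im) → MvPolynomial.aeval z f ≠ 0

namespace Stirling

/-- The letter `π_i` of a word `π = π_1 ⋯ π_m`, with `π_0 = 0` (and `π_i = 0` for `i > m`). -/
def letter (π : List ℕ) (i : ℕ) : ℕ := (0 :: π).getD i 0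

/-- The multiset `{1, 1, 2, 2, …, n, n}`. -/
def doubled (n : ℕ) : Multiset ℕ := 2 • (Finset.Icc 1 n).val

/-- Every letter between two occurrences of the same letter is larger than that letter. -/
def IsStirling (π : List ℕ) : Prop :=
  ∀ j ≤ π.length, ∀ k < j, ∀ i < k, 1 ≤ i →
    letter π i = letter π j → letter π i < letter π k

instance : DecidablePred IsStirling := fun π => by
  unfold IsStirling; infer_instance

/-- `Q_n`, the set of Stirling permutations of `{1, 1, 2, 2, …, n, n}`. -/
def Q (n : ℕ) : Finset (List ℕ) := (doubled n).lists.toFinset.filter IsStirling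

/-- The set of plateaux: the positions `1 ≤ i < m` with `π_i = π_{i+1}`. -/
def P (π : List ℕ) : Finset ℕ :=
  (Finset.Ico 1 π.length).filter fun i => letter π i = letter π (i + 1)

/-- The set of first-appearance ascents: the positions `0 ≤ i < m` with `π_i < π_{i+1}` such that
`π_i` does not occur among `π_1, …, π_{i-1}`. -/
def FA (π : List ℕ) : Finset ℕ :=
  (Finset.range π.length).filter fun i =>
    letter π i < letter π (i + 1) ∧ ∀ j < i, 1 ≤ j → letter π j ≠ letter π i

/-- The multivariate polynomial `∑_{π ∈ Q_n} ∏_{i ∈ P(π)} x_{π_i} ∏_{j ∈ FA(π)} y_{π_{j+1}}`.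
The variable `x_k` is `X (Sum.inl k)` and `y_k` is `X (Sum.inr k)`; only indices `1 ≤ k ≤ n`
occur. -/
noncomputable def stirlingPoly (n : ℕ) : MvPolynomial (ℕ ⊕ ℕ) ℝ :=
  ∑ π ∈ Q n,
    (∏ i ∈ P π, MvPolynomial.X (Sum.inl (letter π i))) *
      ∏ j ∈ FA π, MvPolynomial.X (Sum.inr (letter π (j + 1)))

end Stirling

/-! Write F_n for the polynomial. A word in Q_{n+1} arises uniquely from one in Q_n by inserting the
block (n+1)(n+1) into one of 2n+1 gaps. Plateaux and first-appearance ascents together are the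
non-final positions where a letter (or the initial 0) first occurs (`mem_marked`); there are n+1 of
them, with distinct variables (`mark_injOn`). Insertion always creates x_{n+1}; at a marked gap it
also replaces that gap's variable by y_{n+1}. Hence F_{n+1} = x_{n+1}(n F_n + y_{n+1} ∑ ∂_v F_n)
(`multiaffine_Q_succ`). This step preserves stability: for stable multiaffine F, Im(∂_v F / F) ≤ 0
on the upper half-plane, whereas a zero of the bracket would force ∑ ∂_v F / F = -n / y_{n+1}, of
positive imaginary part. -/

open Finset

/-! ### Stability of multiaffine polynomials -/

section MultiaffineStability

variable {α σ : Type*} [DecidableEq σ]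

/-- The multiaffine polynomial function attached to a family of finite sets of variables. -/
noncomputable def multiaffine (A : Finset α) (S : α → Finset σ) (z : σ → ℂ) : ℂ :=
  ∑ a ∈ A, ∏ v ∈ S a, z v

/-- The partial derivative of `multiaffine A S` with respect to the variable `v`. -/
noncomputable def multiaffineDeriv (A : Finset α) (S : α → Finset σ) (v : σ) (z : σ → ℂ) : ℂ :=
  ∑ a ∈ A, if v ∈ S a then ∏ u ∈ (S a).erase v, z u else 0

theorem multiaffine_update_add (A : Finset α) (S : α → Finset σ) (v : σ) (z : σ → ℂ) (t : ℂ) :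
    multiaffine A S (Function.update z v (z v + t)) =
      multiaffine A S z + t * multiaffineDeriv A S v z := by
  unfold multiaffine multiaffineDeriv
  rw [mul_sum, ← sum_add_distrib]
  refine sum_congr rfl fun a _ => ?_
  split_ifs with h
  · rw [← mul_prod_erase _ _ h, ← mul_prod_erase _ _ h, Function.update_self]
    have : ∏ x ∈ (S a).erase v, Function.update z v (z v + t) x = ∏ x ∈ (S a).erase v, z x :=
      prod_congr rfl fun x hx => Function.update_of_ne (ne_of_mem_erase hx) _ _
    rw [this]; ring
  · rw [mul_zero, add_zero]
    exact prod_congr rfl fun x hx =>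
      Function.update_of_ne (by rintro rfl; exact h hx) _ _

theorem neg_inv_im_pos {w : ℂ} (hw : 0 < w.im) : 0 < (-w⁻¹).im := by
  have h0 : w ≠ 0 := by rintro rfl; simp at hw
  rw [Complex.neg_im, Complex.inv_im, neg_div, neg_neg]
  exact div_pos hw (Complex.normSq_pos.2 h0)

theorem multiaffineDeriv_div_im_nonpos {A : Finset α} {S : α → Finset σ}
    (hA : ∀ z : σ → ℂ, (∀ i, 0 < (z i).im) → multiaffine A S z ≠ 0)
    {z : σ → ℂ} (hz : ∀ i, 0 < (z i).im) (v : σ) :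
    (multiaffineDeriv A S v z / multiaffine A S z).im ≤ 0 := by
  by_contra! h
  have hne : multiaffineDeriv A S v z ≠ 0 := by
    intro h0; simp [h0] at h
  have ht := neg_inv_im_pos h
  -- F is affine in the variable `v`, and moving it by this `t` reaches its root without leaving the
  -- upper half-plane.
  set t := -(multiaffineDeriv A S v z / multiaffine A S z)⁻¹ with ht_def
  refine hA (Function.update z v (z v + t)) (fun i => ?_) ?_
  · by_cases hi : i = v
    · subst hi; simpa using add_pos (hz i) ht
    · simpa [Function.update_of_ne hi] using hz i
  · rw [multiaffine_update_add, ht_def, inv_div, neg_mul, div_mul_cancel₀ _ hne, add_neg_cancel]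

theorem natCast_mul_add_mul_sum_deriv_ne_zero {A : Finset α} {S : α → Finset σ}
    (hA : ∀ z : σ → ℂ, (∀ i, 0 < (z i).im) → multiaffine A S z ≠ 0)
    {z : σ → ℂ} (hz : ∀ i, 0 < (z i).im) {m : ℕ} (hm : 0 < m) {b : ℂ} (hb : 0 < b.im)
    (V : Finset σ) :
    m * multiaffine A S z + b * ∑ v ∈ V, multiaffineDeriv A S v z ≠ 0 := by
  intro h
  have hF := hA z hz
  set w := ∑ v ∈ V, multiaffineDeriv A S v z / multiaffine A S z with hw
  have hw_im : w.im ≤ 0 := by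
    rw [hw, Complex.im_sum]
    exact sum_nonpos fun v _ => multiaffineDeriv_div_im_nonpos hA hz v
  have hmw : (m : ℂ) + b * w = 0 := by
    rw [hw, ← sum_div]
    field_simp
    linear_combination h
  have hm' : (0 : ℝ) < m := by exact_mod_cast hm
  have key : w = m * -b⁻¹ := by
    have hb0 : b ≠ 0 := by rintro rfl; simp at hb
    field_simp
    linear_combination hmw
  have : 0 < w.im := by
    rw [key, ← Complex.ofReal_natCast, Complex.im_ofReal_mul]
    exact mul_pos hm' (neg_inv_im_pos hb)
  linarith

theorem sum_multiaffineDeriv (A : Finset α) (S : α → Finset σ) (V : Finset σ)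
    (hV : ∀ a ∈ A, S a ⊆ V) (z : σ → ℂ) :
    ∑ v ∈ V, multiaffineDeriv A S v z = ∑ a ∈ A, ∑ v ∈ S a, ∏ u ∈ (S a).erase v, z u := by
  unfold multiaffineDeriv
  rw [sum_comm]
  refine sum_congr rfl fun a ha => ?_
  rw [← sum_filter, filter_mem_eq_inter, inter_eq_right.2 (hV a ha)]

end MultiaffineStability

namespace Stirling

/-! ### Letters and multiplicities -/

theorem letter_zero (π : List ℕ) : letter π 0 = 0 := rfl

theorem letter_succ (π : List ℕ) (i : ℕ) : letter π (i + 1) = π.getD i 0 := rfl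

theorem letter_mem {π : List ℕ} {i : ℕ} (h1 : 1 ≤ i) (h2 : i ≤ π.length) : letter π i ∈ π := by
  obtain ⟨i, rfl⟩ := Nat.exists_eq_add_of_le' h1
  rw [letter_succ, List.getD_eq_getElem _ _ (by omega)]
  exact List.getElem_mem _

theorem letter_le {π : List ℕ} {n : ℕ} (h : ∀ a ∈ π, a ≤ n) (i : ℕ) : letter π i ≤ n := by
  rcases Nat.eq_zero_or_pos i with rfl | hi
  · simp [letter_zero]
  · by_cases h2 : i ≤ π.length
    · exact h _ (letter_mem hi h2)
    · obtain ⟨i, rfl⟩ := Nat.exists_eq_add_of_le' hi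
      rw [letter_succ, List.getD_eq_default _ _ (by omega)]
      exact Nat.zero_le _

theorem mem_Q {n : ℕ} {π : List ℕ} : π ∈ Q n ↔ (π : Multiset ℕ) = doubled n ∧ IsStirling π := by
  simp [Q, Multiset.mem_lists_iff, eq_comm]

theorem doubled_succ (n : ℕ) : doubled (n + 1) = (n + 1) ::ₘ (n + 1) ::ₘ doubled n := by
  unfold doubled
  rw [← Finset.insert_Icc_right_eq_Icc_add_one (by omega), Finset.insert_val_of_notMem (by simp)]
  simp [two_nsmul]

theorem mem_doubled {n a : ℕ} : a ∈ doubled n ↔ 1 ≤ a ∧ a ≤ n := by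
  simp [doubled, two_nsmul]

theorem mem_of_mem_Q {n : ℕ} {π : List ℕ} (h : π ∈ Q n) {a : ℕ} : a ∈ π ↔ 1 ≤ a ∧ a ≤ n := by
  rw [← mem_doubled, ← (mem_Q.1 h).1, Multiset.mem_coe]

theorem length_of_mem_Q {n : ℕ} {π : List ℕ} (h : π ∈ Q n) : π.length = 2 * n := by
  rw [← Multiset.coe_card, (mem_Q.1 h).1]
  simp [doubled]

theorem count_of_mem_Q {n : ℕ} {π : List ℕ} (h : π ∈ Q n) {a : ℕ} (ha : a ∈ π) :
    π.count a = 2 := by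
  rw [← Multiset.coe_count, (mem_Q.1 h).1]
  have := (mem_of_mem_Q h).1 ha
  rw [doubled, Multiset.count_nsmul, Multiset.count_eq_one_of_mem (Finset.nodup _) (by simpa)]

/-! ### Insertion of the two largest letters -/

/-- Insert two adjacent copies of `N` after the first `i` letters of `π`. -/
def ins (N : ℕ) (π : List ℕ) (i : ℕ) : List ℕ := π.take i ++ N :: N :: π.drop i

/-- The position in `ins N π i` of the letter at position `j` of `π`. -/
def shift (i j : ℕ) : ℕ := if j ≤ i then j else j + 2

theorem length_ins (N : ℕ) (π : List ℕ) (i : ℕ) : (ins N π i).length = π.length + 2 := by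
  simp [ins]; omega

theorem letter_ins {N : ℕ} {π : List ℕ} {i : ℕ} (hi : i ≤ π.length) (j : ℕ) :
    letter (ins N π i) j =
      if j ≤ i then letter π j else if j ≤ i + 2 then N else letter π (j - 2) := by
  rcases j with _ | j
  · simp [letter_zero]
  · have hl : (π.take i).length = i := by simp [hi]
    rw [letter_succ, ins]
    split_ifs with h1 h2
    · rw [List.getD_append _ _ _ _ (by omega), letter_succ]
      simp [List.getD_eq_getElem?_getD, show j < i by omega]
    · rw [List.getD_append_right _ _ _ _ (by omega), hl]
      obtain h | h : j - i = 0 ∨ j - i = 1 := by omega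
      all_goals simp [h]
    · rw [List.getD_append_right _ _ _ _ (by omega), hl]
      obtain ⟨k, rfl⟩ : ∃ k, j = i + (k + 2) := ⟨j - i - 2, by omega⟩
      rw [show i + (k + 2) + 1 - 2 = i + k + 1 by omega, letter_succ]
      simp [List.getD_eq_getElem?_getD, List.getElem?_drop]

theorem letter_ins_shift {N : ℕ} {π : List ℕ} {i : ℕ} (hi : i ≤ π.length) (j : ℕ) :
    letter (ins N π i) (shift i j) = letter π j := by
  rw [letter_ins hi, shift]
  grind

theorem isStirling_of_ins {N : ℕ} {π : List ℕ} {i : ℕ} (hi : i ≤ π.length)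
    (h : IsStirling (ins N π i)) : IsStirling π := by
  intro c hc b hb a ha h1 hac
  have := h (shift i c) (by rw [length_ins, shift]; grind) (shift i b) (by unfold shift; grind)
    (shift i a) (by unfold shift; grind) (by unfold shift; grind)
  simp only [letter_ins_shift hi] at this
  exact this hac

theorem isStirling_ins {n : ℕ} {π : List ℕ} {i : ℕ} (hi : i ≤ π.length) (hn : ∀ a ∈ π, a ≤ n)
    (h : IsStirling π) : IsStirling (ins (n + 1) π i) := by
  intro c hc b hb a ha h1
  rw [length_ins] at hc
  have la := letter_le hn a
  have la2 := letter_le hn (a - 2)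
  have lc := letter_le hn c
  have lc2 := letter_le hn (c - 2)
  -- Old positions split as left or right of the new block, giving the four cases `e1` to `e4`. The
  -- two new letters are adjacent, so nothing lies between them.
  have H := fun c' b' a' (h1 : c' ≤ π.length) (h2 : b' < c') (h3 : a' < b') (h4 : 1 ≤ a') =>
    h c' h1 b' h2 a' h3 h4
  have e1 := H c b a
  have e2 := H (c - 2) b a
  have e3 := H (c - 2) (b - 2) a
  have e4 := H (c - 2) (b - 2) (a - 2)
  simp only [letter_ins hi]
  split_ifs <;> intro hac <;> omega

theorem coe_ins (N : ℕ) (π : List ℕ) (i : ℕ) :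
    (ins N π i : Multiset ℕ) = N ::ₘ N ::ₘ (π : Multiset ℕ) := by
  rw [Multiset.cons_coe, Multiset.cons_coe, Multiset.coe_eq_coe, ins]
  refine List.perm_middle.trans (List.Perm.cons _ (List.perm_middle.trans ?_))
  rw [List.take_append_drop]

theorem ins_mem_Q {n : ℕ} {π : List ℕ} (h : π ∈ Q n) {i : ℕ} (hi : i ≤ 2 * n) :
    ins (n + 1) π i ∈ Q (n + 1) := by
  have hl := length_of_mem_Q h
  refine mem_Q.2 ⟨?_, isStirling_ins (by omega) (fun a ha => ((mem_of_mem_Q h).1 ha).2)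
    (mem_Q.1 h).2⟩
  rw [coe_ins, (mem_Q.1 h).1, doubled_succ]

theorem exists_ins_of_mem_Q_succ {n : ℕ} {π : List ℕ} (h : π ∈ Q (n + 1)) :
    ∃ ρ ∈ Q n, ∃ i ≤ 2 * n, ins (n + 1) ρ i = π := by
  have hmem : n + 1 ∈ π := (mem_of_mem_Q h).2 ⟨by omega, le_rfl⟩
  have hcount := count_of_mem_Q h hmem
  obtain ⟨p, r, rfl, hp⟩ := List.eq_append_cons_of_mem hmem
  have hr : n + 1 ∈ r := by
    by_contra hr
    simp [List.count_append, List.count_eq_zero_of_not_mem hp,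
      List.count_eq_zero_of_not_mem hr] at hcount
  obtain ⟨s, q, rfl, hs⟩ := List.eq_append_cons_of_mem hr
  -- A letter between the two copies of the maximum would have to exceed it.
  have hs0 : s = [] := by
    rcases s with _ | ⟨k, s⟩
    · rfl
    · exfalso
      have hk : k ≤ n + 1 := ((mem_of_mem_Q h).1 (by simp)).2
      have := (mem_Q.1 h).2 (p.length + s.length + 3) (by simp; omega) (p.length + 2) (by omega)
        (p.length + 1) (by omega) (by omega)
      simp only [letter_succ] at this
      rw [List.getD_append_right _ _ _ _ le_rfl, List.getD_append_right _ _ _ _ (by omega),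
        List.getD_append_right _ _ _ _ (by omega)] at this
      simp [show p.length + s.length + 2 - p.length = s.length + 2 by omega] at this
      omega
  subst hs0
  have hins : ins (n + 1) (p ++ q) p.length = p ++ (n + 1) :: ([] ++ (n + 1) :: q) := by
    simp [ins]
  rw [← hins] at h
  have hQ : p ++ q ∈ Q n := by
    refine mem_Q.2 ⟨?_, isStirling_of_ins (by simp) (mem_Q.1 h).2⟩
    have := (mem_Q.1 h).1
    rw [coe_ins, doubled_succ] at this
    exact (Multiset.cons_inj_right _).1 ((Multiset.cons_inj_right _).1 this)
  refine ⟨p ++ q, hQ, p.length, ?_, hins⟩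
  have := length_of_mem_Q hQ
  simp at this
  omega

/-- Deleting `N` recovers the word; the index of the first `N` recovers the gap. -/
theorem ins_injective {N : ℕ} {π ρ : List ℕ} {i j : ℕ} (hi : i ≤ π.length) (hj : j ≤ ρ.length)
    (hπ : N ∉ π) (hρ : N ∉ ρ) (h : ins N π i = ins N ρ j) : π = ρ ∧ i = j := by
  have filter_ins : ∀ {π : List ℕ} {i : ℕ}, N ∉ π → (ins N π i).filter (· ≠ N) = π := by
    intro π i hπ
    have : π.filter (· ≠ N) = π := List.filter_eq_self.2 fun a ha => by
      simpa using ne_of_mem_of_not_mem ha hπ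
    rw [ins, List.filter_append, List.filter_cons_of_neg (by simp),
      List.filter_cons_of_neg (by simp), ← List.filter_append, List.take_append_drop, this]
  have idxOf_ins : ∀ {π : List ℕ} {i : ℕ}, i ≤ π.length → N ∉ π → (ins N π i).idxOf N = i := by
    intro π i hi hπ
    rw [ins, List.idxOf_append_of_notMem fun h => hπ (List.mem_of_mem_take h)]
    simp [hi]
  exact ⟨by rw [← filter_ins (i := i) hπ, h, filter_ins hρ],
    by rw [← idxOf_ins hi hπ, h, idxOf_ins hj hρ]⟩

theorem sum_Q_succ {M : Type*} [AddCommMonoid M] (n : ℕ) (f : List ℕ → M) :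
    ∑ π ∈ Q (n + 1), f π = ∑ π ∈ Q n, ∑ i ∈ range (2 * n + 1), f (ins (n + 1) π i) := by
  rw [← sum_product']
  symm
  refine sum_bij (fun x _ => ins (n + 1) x.1 x.2) ?_ ?_ ?_ fun _ _ => rfl
  · rintro ⟨π, i⟩ hx
    simp only [mem_product, Finset.mem_range] at hx
    exact ins_mem_Q hx.1 (by omega)
  · rintro ⟨π, i⟩ hx ⟨ρ, j⟩ hy h
    simp only [mem_product, Finset.mem_range] at hx hy
    have notMem : ∀ {π}, π ∈ Q n → n + 1 ∉ π := fun hπ hmem => by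
      have := (mem_of_mem_Q hπ).1 hmem
      omega
    have := ins_injective (by rw [length_of_mem_Q hx.1]; omega)
      (by rw [length_of_mem_Q hy.1]; omega) (notMem hx.1) (notMem hy.1) h
    exact Prod.ext this.1 this.2
  · intro π hπ
    obtain ⟨ρ, hρ, i, hi, rfl⟩ := exists_ins_of_mem_Q_succ hπ
    exact ⟨(ρ, i), by simp [hρ]; omega, rfl⟩

/-! ### Marked positions and their variables -/

/-- The positions contributing a variable: plateaux and first-appearance ascents. -/
def marked (π : List ℕ) : Finset ℕ := P π ∪ FA π

/-- The variable contributed by a marked position. -/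
def mark (π : List ℕ) (i : ℕ) : ℕ ⊕ ℕ :=
  if letter π i = letter π (i + 1) then Sum.inl (letter π i) else Sum.inr (letter π (i + 1))

theorem prod_marked {R : Type*} [CommMonoid R] (π : List ℕ) (z : ℕ ⊕ ℕ → R) :
    (∏ i ∈ P π, z (Sum.inl (letter π i))) * ∏ j ∈ FA π, z (Sum.inr (letter π (j + 1))) =
      ∏ i ∈ marked π, z (mark π i) := by
  have hd : Disjoint (P π) (FA π) := by
    rw [Finset.disjoint_left]
    intro i h1 h2
    simp only [P, FA, Finset.mem_filter] at h1 h2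
    omega
  rw [marked, prod_union hd]
  congr 1
  · refine prod_congr rfl fun i hi => ?_
    rw [mark, if_pos (Finset.mem_filter.1 hi).2]
  · refine prod_congr rfl fun i hi => ?_
    rw [mark, if_neg (Finset.mem_filter.1 hi).2.1.ne]

/-- A repeated x would need a third copy of a letter, the middle one violating the Stirling
condition. A repeated y would put the bottom of the second ascent between two copies of its top. -/
theorem mark_injOn {π : List ℕ} (h : IsStirling π) : Set.InjOn (mark π) (marked π) := by
  have key : ∀ i ∈ marked π, ∀ j ∈ marked π, i < j → mark π i ≠ mark π j := by
    intro i hi j hj hij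
    simp only [marked, P, FA, Finset.mem_union, Finset.mem_filter, Finset.mem_Ico,
      Finset.mem_range] at hi hj
    have h1 := h (j + 1) (by omega) j (by omega) i hij
    have h2 := h (j + 1) (by omega) j (by omega) (i + 1)
    unfold mark
    split_ifs with e1 e2 e2
    · intro e
      simp only [Sum.inl.injEq] at e
      have := h1 (by omega) (by omega)
      omega
    · simp
    · simp
    · intro e
      simp only [Sum.inr.injEq] at e
      obtain rfl | hlt : i + 1 = j ∨ i + 1 < j := by omega
      · omega
      · have := h2 hlt (by omega) e
        omega
  intro i hi j hj e
  by_contra hne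
  rcases Nat.lt_or_gt_of_ne hne with hlt | hlt
  · exact key i hi j hj hlt e
  · exact key j hj i hi hlt e.symm

theorem exists_other_position {n : ℕ} {π : List ℕ} (h : π ∈ Q n) {j : ℕ} (h1 : 1 ≤ j)
    (h2 : j ≤ π.length) : ∃ k, 1 ≤ k ∧ k ≤ π.length ∧ k ≠ j ∧ letter π k = letter π j := by
  have hc := count_of_mem_Q h (letter_mem h1 h2)
  obtain ⟨a, b, hab, ea, eb⟩ :=
    List.duplicate_iff_exists_distinct_get.1 (List.duplicate_iff_two_le_count.2 hc.ge)
  have letter_get : ∀ a : Fin π.length, letter π (a + 1) = π.get a := fun a => by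
    rw [letter_succ, List.getD_eq_getElem _ _ a.2, List.get_eq_getElem]
  have hab' : (a : ℕ) < b := hab
  by_cases haj : (a : ℕ) + 1 = j
  · exact ⟨b + 1, by omega, b.2, by omega, by rw [letter_get, ← eb]⟩
  · exact ⟨a + 1, by omega, a.2, haj, by rw [letter_get, ← ea]⟩

/-- After a first occurrence the second copy is still to come, so the next letter is either that
copy (plateau) or larger (ascent). -/
theorem mem_marked {n : ℕ} {π : List ℕ} (h : π ∈ Q n) {j : ℕ} :
    j ∈ marked π ↔ j < π.length ∧ ∀ k < j, 1 ≤ k → letter π k ≠ letter π j := by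
  have hS := (mem_Q.1 h).2
  simp only [marked, P, FA, Finset.mem_union, Finset.mem_filter, Finset.mem_Ico, Finset.mem_range]
  constructor
  · rintro (⟨⟨h1, h2⟩, e⟩ | ⟨h1, h2, h3⟩)
    · refine ⟨h2, fun k hk hk1 e' => ?_⟩
      have := hS (j + 1) (by omega) j (by omega) k hk hk1 (by omega)
      omega
    · exact ⟨h1, h3⟩
  · rintro ⟨h1, h2⟩
    rcases Nat.eq_zero_or_pos j with rfl | hj
    · refine Or.inr ⟨h1, ?_, h2⟩
      rw [letter_zero]
      exact ((mem_of_mem_Q h).1 (letter_mem (by omega) (by omega))).1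
    · obtain ⟨k, hk1, hk2, hkj, e⟩ := exists_other_position h hj h1.le
      have hjk : j < k := by
        by_contra hlt
        exact h2 k (by omega) hk1 e
      obtain rfl | hlt : k = j + 1 ∨ j + 1 < k := by omega
      · exact Or.inl ⟨⟨hj, h1⟩, e.symm⟩
      · exact Or.inr ⟨h1, hS k hk2 (j + 1) hlt j (by omega) hj e.symm, h2⟩

theorem shift_injective (i : ℕ) : Function.Injective (shift i) := by
  intro a b h
  unfold shift at h
  grind

theorem marked_ins {n : ℕ} (hn : 0 < n) {π : List ℕ} (h : π ∈ Q n) {i : ℕ} (hi : i ≤ 2 * n) :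
    marked (ins (n + 1) π i) = insert (i + 1) ((marked π).image (shift i)) := by
  have hl := length_of_mem_Q h
  have hil : i ≤ π.length := by omega
  have hle := letter_le fun a ha => ((mem_of_mem_Q h).1 ha).2
  ext j
  rw [mem_marked (ins_mem_Q h hi), length_ins, Finset.mem_insert, Finset.mem_image]
  constructor
  · rintro ⟨h1, h2⟩
    by_cases hj : j = i + 1
    · exact Or.inl hj
    refine Or.inr ?_
    have hj2 : j ≠ i + 2 := by
      rintro rfl
      refine h2 (i + 1) (by omega) (by omega) ?_
      simp [letter_ins hil]
    obtain ⟨k, rfl⟩ : ∃ k, shift i k = j := by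
      by_cases hji : j ≤ i
      · exact ⟨j, by simp [shift, hji]⟩
      · exact ⟨j - 2, by unfold shift; grind⟩
    have hfirst : ∀ l < k, 1 ≤ l → letter π l ≠ letter π k := fun l hl hl1 => by
      have := h2 (shift i l) (by unfold shift; grind) (by unfold shift; grind)
      rwa [letter_ins_shift hil, letter_ins_shift hil] at this
    refine ⟨k, (mem_marked h).2 ⟨?_, hfirst⟩, rfl⟩
    have hk : k ≤ π.length := by unfold shift at h1; grind
    refine lt_of_le_of_ne hk fun hkl => ?_
    -- The last letter of the word is never a first occurrence.
    obtain ⟨m, hm1, hm2, hmk, e⟩ := exists_other_position h (j := k) (by omega) hk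
    exact hfirst m (by omega) hm1 e
  · rintro (rfl | ⟨k, hk, rfl⟩)
    · refine ⟨by omega, fun k hk hk1 => ?_⟩
      have := hle k
      rw [letter_ins hil, letter_ins hil, if_pos (by omega), if_neg (by omega),
        if_pos (by omega)]
      omega
    · obtain ⟨hk1, hk2⟩ := (mem_marked h).1 hk
      refine ⟨by unfold shift; grind, fun m hm hm1 => ?_⟩
      rw [letter_ins_shift hil, letter_ins hil]
      have := hle k
      unfold shift at hm
      split_ifs with c1 c2
      · exact hk2 m (by grind) hm1
      · omega
      · exact hk2 (m - 2) (by grind) (by omega)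

theorem succ_notMem_image_shift (i : ℕ) (s : Finset ℕ) : i + 1 ∉ s.image (shift i) := by
  rw [Finset.mem_image]
  rintro ⟨k, -, hk⟩
  unfold shift at hk
  grind

theorem mark_ins_succ {N : ℕ} {π : List ℕ} {i : ℕ} (hi : i ≤ π.length) :
    mark (ins N π i) (i + 1) = Sum.inl N := by
  simp [mark, letter_ins hi]

/-- Only position `i` gets a new right neighbour, and that neighbour exceeds every old letter. -/
theorem mark_ins_shift {n : ℕ} {π : List ℕ} (hn : ∀ a ∈ π, a ≤ n) {i : ℕ} (hi : i ≤ π.length)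
    (j : ℕ) :
    mark (ins (n + 1) π i) (shift i j) = if j = i then Sum.inr (n + 1) else mark π j := by
  unfold mark
  rw [letter_ins_shift hi]
  split_ifs with h1 h2 h3 h4
  · subst h2
    have := letter_le hn j
    rw [letter_ins hi, shift] at h1
    simp at h1
    omega
  · rfl
  · exfalso
    rw [show shift i j + 1 = shift i (j + 1) by unfold shift; grind, letter_ins_shift hi] at h1
    exact h3 h1
  · subst h4
    rw [letter_ins hi, shift]
    simp
  · rename_i h5
    exfalso
    rw [show shift i j + 1 = shift i (j + 1) by unfold shift; grind, letter_ins_shift hi] at h1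
    exact h1 h5
  · rw [show shift i j + 1 = shift i (j + 1) by unfold shift; grind, letter_ins_shift hi]

/-! ### Base case, counting and the recursion -/

theorem Q_zero : Q 0 = {[]} := by
  ext π
  rw [mem_Q, Finset.mem_singleton]
  constructor
  · rintro ⟨h, -⟩
    simpa [doubled] using h
  · rintro rfl
    refine ⟨by simp [doubled], fun j hj k hk => ?_⟩
    simp at hj
    omega

theorem Q_one : Q 1 = {[1, 1]} := by
  have h : ∀ π, π ∈ Q 1 ↔ π = [1, 1] := by
    intro π
    constructor
    · intro h
      obtain ⟨ρ, hρ, i, hi, rfl⟩ := exists_ins_of_mem_Q_succ h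
      rw [Q_zero, Finset.mem_singleton] at hρ
      subst hρ
      simp [ins]
    · rintro rfl
      exact ins_mem_Q (n := 0) (π := []) (i := 0) (by simp [Q_zero]) le_rfl
  ext π
  simp [h]

theorem marked_one : marked [1, 1] = {0, 1} := by decide

theorem card_marked {n : ℕ} (hn : 0 < n) : ∀ {π : List ℕ}, π ∈ Q n → #(marked π) = n + 1 := by
  induction n, hn using Nat.le_induction with
  | base =>
    intro π h
    change π ∈ Q 1 at h
    rw [Q_one, Finset.mem_singleton] at h
    rw [h, marked_one]; rfl
  | succ n hn ih =>
    intro π h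
    obtain ⟨ρ, hρ, i, hi, rfl⟩ := exists_ins_of_mem_Q_succ h
    rw [marked_ins hn hρ hi, card_insert_of_notMem (succ_notMem_image_shift _ _),
      card_image_of_injective _ (shift_injective i), ih hρ]

theorem prod_marked_ins {R : Type*} [CommMonoid R] {n : ℕ} (hn : 0 < n) {π : List ℕ} (h : π ∈ Q n)
    {i : ℕ} (hi : i ≤ 2 * n) (z : ℕ ⊕ ℕ → R) :
    ∏ j ∈ marked (ins (n + 1) π i), z (mark (ins (n + 1) π i) j) =
      z (Sum.inl (n + 1)) *
        ∏ j ∈ marked π, if j = i then z (Sum.inr (n + 1)) else z (mark π j) := by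
  have hl : i ≤ π.length := by rw [length_of_mem_Q h]; exact hi
  rw [marked_ins hn h hi, prod_insert (succ_notMem_image_shift _ _), mark_ins_succ hl,
    prod_image (shift_injective i).injOn]
  congr 1
  refine prod_congr rfl fun j _ => ?_
  rw [mark_ins_shift (fun a ha => ((mem_of_mem_Q h).1 ha).2) hl, apply_ite z]

theorem sum_prod_marked_ins {R : Type*} [CommSemiring R] {n : ℕ} (hn : 0 < n) {π : List ℕ}
    (h : π ∈ Q n) (z : ℕ ⊕ ℕ → R) :
    ∑ i ∈ range (2 * n + 1), ∏ j ∈ marked (ins (n + 1) π i), z (mark (ins (n + 1) π i) j) =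
      z (Sum.inl (n + 1)) * (n * ∏ j ∈ marked π, z (mark π j) +
        z (Sum.inr (n + 1)) * ∑ i ∈ marked π, ∏ j ∈ (marked π).erase i, z (mark π j)) := by
  have hsub : marked π ⊆ range (2 * n + 1) := fun j hj => by
    have := ((mem_marked h).1 hj).1
    rw [length_of_mem_Q h] at this
    exact Finset.mem_range.2 (by omega)
  rw [sum_congr rfl fun i hi => prod_marked_ins hn h
    (Nat.lt_succ_iff.1 (Finset.mem_range.1 hi)) z, ← mul_sum, ← sum_sdiff hsub, mul_sum (marked π)]
  congr 2
  · have hcard : #(range (2 * n + 1) \ marked π) = n := by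
      rw [card_sdiff_of_subset hsub, card_range, card_marked hn h]; omega
    rw [← nsmul_eq_mul, ← hcard, ← sum_const, hcard]
    refine sum_congr rfl fun i hi => prod_congr rfl fun j hj => if_neg ?_
    rintro rfl
    exact (Finset.mem_sdiff.1 hi).2 hj
  · refine sum_congr rfl fun i hi => ?_
    rw [← mul_prod_erase _ _ hi, if_pos rfl]
    congr 1
    exact prod_congr rfl fun j hj => if_neg (ne_of_mem_erase hj)

/-- The set of variables dividing the monomial of `π`. -/
def support (π : List ℕ) : Finset (ℕ ⊕ ℕ) := (marked π).image (mark π)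

theorem prod_support {π : List ℕ} (h : IsStirling π) (z : ℕ ⊕ ℕ → ℂ) :
    ∏ v ∈ support π, z v = ∏ j ∈ marked π, z (mark π j) :=
  prod_image (mark_injOn h)

theorem sum_prod_erase_support {π : List ℕ} (h : IsStirling π) (z : ℕ ⊕ ℕ → ℂ) :
    ∑ v ∈ support π, ∏ u ∈ (support π).erase v, z u =
      ∑ i ∈ marked π, ∏ j ∈ (marked π).erase i, z (mark π j) := by
  have hinj := mark_injOn h
  rw [support, sum_image hinj]
  refine sum_congr rfl fun i hi => ?_
  rw [← prod_image (g := mark π) (f := z)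
    (hinj.mono (Finset.coe_subset.2 (erase_subset _ _)))]
  refine prod_congr ?_ fun _ _ => rfl
  ext v
  simp only [Finset.mem_erase, Finset.mem_image]
  constructor
  · rintro ⟨hv, j, hj, rfl⟩
    exact ⟨j, ⟨fun e => hv (e ▸ rfl), hj⟩, rfl⟩
  · rintro ⟨j, ⟨hji, hj⟩, rfl⟩
    exact ⟨fun e => hji (hinj hj hi e), j, hj, rfl⟩

/-- Injectivity of `mark` makes every monomial squarefree, so a set of variables encodes it
faithfully. -/
theorem aeval_stirlingPoly (n : ℕ) (z : ℕ ⊕ ℕ → ℂ) :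
    MvPolynomial.aeval z (stirlingPoly n) = multiaffine (Q n) support z := by
  rw [stirlingPoly, map_sum, multiaffine]
  refine sum_congr rfl fun π hπ => ?_
  rw [prod_support (mem_Q.1 hπ).2, ← prod_marked]
  simp [map_prod]

theorem multiaffine_Q_succ {n : ℕ} (hn : 0 < n) (z : ℕ ⊕ ℕ → ℂ) :
    multiaffine (Q (n + 1)) support z = z (Sum.inl (n + 1)) *
      (n * multiaffine (Q n) support z + z (Sum.inr (n + 1)) *
        ∑ v ∈ (Q n).biUnion support, multiaffineDeriv (Q n) support v z) := by
  rw [sum_multiaffineDeriv _ _ _ fun a ha => subset_biUnion_of_mem support ha]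
  unfold multiaffine
  rw [sum_congr rfl fun π hπ => prod_support (mem_Q.1 hπ).2 z, sum_Q_succ,
    sum_congr rfl fun π hπ => sum_prod_marked_ins hn hπ z, ← mul_sum, sum_add_distrib,
    ← mul_sum, ← mul_sum, sum_congr rfl fun π hπ => prod_support (mem_Q.1 hπ).2 z,
    sum_congr rfl fun π hπ => sum_prod_erase_support (mem_Q.1 hπ).2 z]

theorem multiaffine_Q_ne_zero {n : ℕ} (hn : 0 < n) :
    ∀ z : ℕ ⊕ ℕ → ℂ, (∀ i, 0 < (z i).im) → multiaffine (Q n) support z ≠ 0 := by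
  have ne_zero : ∀ {w : ℂ}, 0 < w.im → w ≠ 0 := by
    rintro w hw rfl
    simp at hw
  induction n, hn using Nat.le_induction with
  | base =>
    intro z hz
    change multiaffine (Q 1) support z ≠ 0
    rw [Q_one, multiaffine, sum_singleton]
    exact prod_ne_zero_iff.2 fun v _ => ne_zero (hz v)
  | succ n hn ih =>
    intro z hz
    rw [multiaffine_Q_succ hn]
    exact mul_ne_zero (ne_zero (hz _))
      (natCast_mul_add_mul_sum_deriv_ne_zero ih hz hn (hz _) _)

end Stirling

theorem mainTheorem3 (n : ℕ) (hn : 0 < n) : IsRealStable (Stirling.stirlingPoly n) := by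
  refine Or.inr fun z hz => ?_
  rw [Stirling.aeval_stirlingPoly]
  exact Stirling.multiaffine_Q_ne_zero hn z hz
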